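/- \textbf{Theorem (QED limits with retrials).} Consider a queue with $s\ge 1$ parallel servers, Poisson arrivals with rate $\lambda$ and i.i.d. exponential service times with mean one. A customer who finds a free server is admitted; a customer who finds $k\ge s$ customers in the system is admitted with probability $p_k\in[0,1]$ and rejected otherwise. The policy is held fixed as $s$ varies, i.e. $p_{s+n}=q_n$ for a sequence $(q_n)_{n\ge0}$ in $[0,1]$ not depending on $s$. Let $$F(x)=\sum_{n=0}^\infty p_s p_{s+1}\cdots p_{s+n}\,x^{n+1},\qquad P=\limsup_{n\to\infty}(p_s\cdots p_{s+n})^{1/(n+1)},$$ and assume $P\in[0,1)$ and $\lim_{x\uparrow 1/P}F(x)=\infty$ (with $1/P=\infty$ if $P=0$). For $0\le\lambda<s/P$ let $\pi$ be the stationary distribution of the number of customers in the system (a birth-and-death process with birth rates $\lambda p_k$, where $p_k=1$ for $k<s$, and death rates $\min(k,s)$), and let $$D_F(s,\lambda)=\sum_{k\ge s}\pi_k,\qquad D_F^R(s,\lambda)=\sum_{k\ge s}\pi_k(1-p_k)$$ be the stationary probabilities that an arriving customer finds all servers occupied, respectively is rejected. Let $\varphi,\Phi$ be the standard normal density and distribution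 function. Fix $\gamma>0$ and put $\lambda=s-\gamma\sqrt s$. For every $s$ with $\sqrt s\ge\gamma$ the generalized Cohen equation $$\Omega=(\lambda+\Omega)\,D_F^R(s,\lambda+\Omega)$$ has a unique solution $\Omega\ge 0$ with $\lambda+\Omega<s/P$. The equation $$a=\frac{\varphi(\gamma-a)}{\Phi(\gamma-a)}$$ has a unique positive solution $a$, and $$\lim_{s\to\infty}\frac{\Omega}{\sqrt s}=a.$$ Furthermore, with $\bar D_F(s,\lambda)=D_F(s,\lambda+\Omega)$ and $\bar D_F^R(s,\lambda)=D_F^R(s,\lambda+\Omega)$, $$\lim_{s\to\infty}\sqrt s\,\bar D_F(s,s-\gamma\sqrt s)=(1+F(1))\frac{\varphi(\gamma-a)}{\Phi(\gamma-a)},\qquad \lim_{s\to\infty}\sqrt s\,\bar D_F^R(s,s-\gamma\sqrt s)=\frac{\varphi(\gamma-a)}{\Phi(\gamma-a)}.$$ -/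

import Mathlib

open Filter Topology ProbabilityTheory

noncomputable section

namespace RetrialQueue

/-- Density of the standard normal distribution. -/
def phi (x : ℝ) : ℝ := gaussianPDFReal 0 1 x

/-- Cumulative distribution function of the standard normal distribution. -/
def Phi (x : ℝ) : ℝ := cdf (gaussianReal 0 1) x

/-! An admission policy is a sequence `q` in `[0, 1]`: in a system with `s` servers, `q n` is the
probability `p_{s+n}` that a customer who finds `s + n` customers in the system is admitted. -/

/-- `F(x) = ∑_{n ≥ 0} p_s ⋯ p_{s+n} x^{n+1}`. -/
def policySeries (q : ℕ → ℝ) (x : ℝ) : ℝ :=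
  ∑' n : ℕ, (∏ i ∈ Finset.range (n + 1), q i) * x ^ (n + 1)

/-- `P = limsup_n (p_s ⋯ p_{s+n})^{1/(n+1)}`, the inverse radius of convergence of `F`. -/
def policyP (q : ℕ → ℝ) : ℝ :=
  limsup (fun n : ℕ => (∏ i ∈ Finset.range (n + 1), q i) ^ (1 / ((n : ℝ) + 1))) atTop

/-- `P ∈ [0, 1)` and `F(x) → ∞` as `x ↑ 1/P`, where `1/P = ∞` if `P = 0`. -/
structure PolicyCondition (q : ℕ → ℝ) : Prop where
  mem_Ico : policyP q ∈ Set.Ico (0 : ℝ) 1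
  tendsto_of_pos : 0 < policyP q → Tendsto (policySeries q) (𝓝[<] (1 / policyP q)) atTop
  tendsto_of_zero : policyP q = 0 → Tendsto (policySeries q) atTop atTop

/-- The probability `p_k` that a customer who finds `k` customers in the system is admitted. -/
def admitProb (q : ℕ → ℝ) (s k : ℕ) : ℝ := if k < s then 1 else q (k - s)

/-- Birth rate of the number of customers in the system, at arrival rate `lam`. -/
def birthRate (q : ℕ → ℝ) (s : ℕ) (lam : ℝ) (k : ℕ) : ℝ := lam * admitProb q s k

/-- Death rate of the number of customers in the system; service times have mean one. -/
def deathRate (s k : ℕ) : ℝ := (min k s : ℕ)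

/-- The solution of the detailed balance equations with value `1` at `0`. -/
def weight (q : ℕ → ℝ) (s : ℕ) (lam : ℝ) (k : ℕ) : ℝ :=
  ∏ i ∈ Finset.range k, birthRate q s lam i / deathRate s (i + 1)

/-- The stationary distribution `π_k` of the number of customers in the system. -/
def stationaryDist (q : ℕ → ℝ) (s : ℕ) (lam : ℝ) (k : ℕ) : ℝ :=
  weight q s lam k / ∑' j, weight q s lam j

/-- `π` is a stationary distribution of the birth-and-death process: a probability vector with
`π Q = 0` for the generator `Q`. -/
structure IsStationary (q : ℕ → ℝ) (s : ℕ) (lam : ℝ) (π : ℕ → ℝ) : Prop where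
  nonneg : ∀ k, 0 ≤ π k
  hasSum : HasSum π 1
  balance_zero : π 0 * birthRate q s lam 0 = π 1 * deathRate s 1
  balance_succ : ∀ k, π (k + 1) * (birthRate q s lam (k + 1) + deathRate s (k + 1)) =
    π k * birthRate q s lam k + π (k + 2) * deathRate s (k + 2)

/-- The stability condition `lam ∈ [0, s / P)`, where `s / P = ∞` if `P = 0`. -/
def IsStable (q : ℕ → ℝ) (s : ℕ) (lam : ℝ) : Prop :=
  0 ≤ lam ∧ (0 < policyP q → lam < s / policyP q)

/-- `D_F(s, lam)`: stationary probability that an arriving customer finds all servers occupied. -/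
def delayProb (q : ℕ → ℝ) (s : ℕ) (lam : ℝ) : ℝ :=
  ∑' n : ℕ, stationaryDist q s lam (s + n)

/-- `D_F^R(s, lam)`: stationary probability that an arriving customer is rejected. -/
def rejectProb (q : ℕ → ℝ) (s : ℕ) (lam : ℝ) : ℝ :=
  ∑' n : ℕ, stationaryDist q s lam (s + n) * (1 - admitProb q s (s + n))

/-- `Om` is a solution of the generalized Cohen equation
`Om = (lam + Om) * D_F^R(s, lam + Om)`, with `lam + Om` in the stability region. -/
structure IsCohenSolution (q : ℕ → ℝ) (s : ℕ) (lam Om : ℝ) : Prop where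
  nonneg : 0 ≤ Om
  stable : IsStable q s (lam + Om)
  equation : Om = (lam + Om) * rejectProb q s (lam + Om)

theorem deathRate_succ_pos {s : ℕ} (hs : 0 < s) (k : ℕ) : 0 < deathRate s (k + 1) := by
  unfold deathRate
  exact_mod_cast lt_min (Nat.succ_pos k) hs

theorem weight_succ {s : ℕ} (hs : 0 < s) (q : ℕ → ℝ) (lam : ℝ) (k : ℕ) :
    weight q s lam (k + 1) * deathRate s (k + 1) = weight q s lam k * birthRate q s lam k := by
  have h := (deathRate_succ_pos hs k).ne'
  unfold weight
  rw [Finset.prod_range_succ]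
  field_simp

theorem weight_nonneg {q : ℕ → ℝ} (hq : ∀ n, q n ∈ Set.Icc (0 : ℝ) 1) (s : ℕ) {lam : ℝ}
    (hl : 0 ≤ lam) (k : ℕ) : 0 ≤ weight q s lam k := by
  refine Finset.prod_nonneg fun i _ => div_nonneg (mul_nonneg hl ?_) (Nat.cast_nonneg _)
  unfold admitProb
  split_ifs
  · exact zero_le_one
  · exact (hq _).1

/-- Whenever the weights are summable, `stationaryDist` is the unique stationary distribution of
the birth-and-death process. -/
theorem isStationary_iff {q : ℕ → ℝ} (hq : ∀ n, q n ∈ Set.Icc (0 : ℝ) 1) {s : ℕ} (hs : 0 < s)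
    {lam : ℝ} (hl : 0 ≤ lam) (hw : Summable (weight q s lam)) (π : ℕ → ℝ) :
    IsStationary q s lam π ↔ π = stationaryDist q s lam := by
  have h0 : weight q s lam 0 = 1 := by simp [weight]
  have hpos : 0 < ∑' j, weight q s lam j :=
    hw.tsum_pos (weight_nonneg hq s hl) 0 (by rw [h0]; exact one_pos)
  constructor
  · intro h
    have hdb : ∀ k, π (k + 1) * deathRate s (k + 1) = π k * birthRate q s lam k := by
      intro k
      induction k with
      | zero => exact h.balance_zero.symm
      | succ k ih => linarith [h.balance_succ k]
    have hk : ∀ k, π k = π 0 * weight q s lam k := by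
      intro k
      induction k with
      | zero => rw [h0, mul_one]
      | succ k ih =>
        apply mul_right_cancel₀ (deathRate_succ_pos hs k).ne'
        rw [hdb, mul_assoc, weight_succ hs, ih, mul_assoc]
    have hsum : π 0 * ∑' j, weight q s lam j = 1 := by
      rw [← tsum_mul_left, ← h.hasSum.tsum_eq]
      exact tsum_congr fun k => (hk k).symm
    funext k
    rw [hk k, stationaryDist, eq_div_iff hpos.ne', mul_right_comm, hsum, one_mul]
  · rintro rfl
    have hdb : ∀ k, stationaryDist q s lam (k + 1) * deathRate s (k + 1) =
        stationaryDist q s lam k * birthRate q s lam k := by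
      intro k
      unfold stationaryDist
      rw [div_mul_eq_mul_div, weight_succ hs, div_mul_eq_mul_div]
    refine ⟨fun k => div_nonneg (weight_nonneg hq s hl k) hpos.le, ?_, (hdb 0).symm, ?_⟩
    · have := hw.hasSum.div_const (∑' j, weight q s lam j)
      rwa [div_self hpos.ne'] at this
    · intro k
      linarith [hdb k, hdb (k + 1)]

end RetrialQueue

end

/-! Let `I(x) = ∑_{k < s} (s - k) π_k` be the mean number of idle servers at arrival rate `x`. In
equilibrium admissions balance departures, so `x * D_F^R(s, x) = x - (s - I(x))`. With
`x = lam + Om` the generalized Cohen equation becomes `I(x) = s - lam`.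

`π` is a power series distribution in the arrival rate and hence stochastically increasing, so `I`
is strictly decreasing, from `I(0) = s` down to `0` because `F(x / s) → ∞` at the end of the
stability region. This gives existence and uniqueness for every `0 ≤ lam < s`.

Writing `ρ(s, x) = (∑_{k < s} x ^ k / k!) / (x ^ s / s!)` for the odds that a server is idle in
Erlang's loss system, the delay probability and `I` are
`D_F = (1 + F(x / s)) / (ρ + 1 + F(x / s))` and `I = ((s - x) ρ + s) / (ρ + 1 + F(x / s))`. If
`x = s - β √s + o(√s)`, the integral representation `ρ + 1 = x ∫_0^∞ (1 + t) ^ s exp (-x t) dt` and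
Laplace's method give `ρ / √s → Φ(β) / φ(β)`, so that `I / √s → β + φ(β) / Φ(β)`. This limit is
strictly increasing in `β`; since `I` equals `s - lam ∼ γ √s` at the Cohen solution, comparing `I`
there with its values at `s - b √s` shows `(s - x) / √s → β`, where `β + φ(β) / Φ(β) = γ`. Then
`a = φ(β) / Φ(β) = γ - β`, which is the equation for `a`. -/

noncomputable section

namespace RetrialQueue

theorem strictMono_of_hasDerivAt_pos_of_ne {f f' : ℝ → ℝ} (c : ℝ) (hf : ∀ x, HasDerivAt f (f' x) x)
    (hf' : ∀ x, x ≠ c → 0 < f' x) : StrictMono f := by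
  have hcont : Continuous f := continuous_iff_continuousAt.2 fun x => (hf x).continuousAt
  refine StrictMonoOn.Iic_union_Ici (a := c)
    (strictMonoOn_of_deriv_pos (convex_Iic c) hcont.continuousOn fun x hx => ?_)
    (strictMonoOn_of_deriv_pos (convex_Ici c) hcont.continuousOn fun x hx => ?_)
  · rw [interior_Iic] at hx
    exact (hf x).deriv ▸ hf' x hx.ne
  · rw [interior_Ici] at hx
    exact (hf x).deriv ▸ hf' x hx.ne'

theorem lt_of_tendsto_atBot_of_strictMono {α β : Type*} [LinearOrder α] [NoMinOrder α]
    [TopologicalSpace β] [Preorder β] [OrderClosedTopology β] {f : α → β} {l : β}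
    (hl : Tendsto f atBot (𝓝 l)) (hf : StrictMono f) (x : α) : l < f x :=
  have ⟨_, hy⟩ := exists_lt x
  (hf.monotone.le_of_tendsto hl _).trans_lt (hf hy)

section Gaussian

open MeasureTheory Set

/-- `φ / Φ`, the inverse Mills ratio of the lower tail: minus the conditional mean of a standard
normal variable given that it is at most `b`. -/
def invMills (b : ℝ) : ℝ := phi b / Phi b

theorem phi_eq (x : ℝ) : phi x = (√(2 * Real.pi))⁻¹ * Real.exp (-x ^ 2 / 2) := by
  simp [phi, gaussianPDFReal]

theorem phi_pos (x : ℝ) : 0 < phi x := gaussianPDFReal_pos 0 1 x one_ne_zero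

theorem hasDerivAt_phi (x : ℝ) : HasDerivAt phi (-x * phi x) x := by
  have h : HasDerivAt (fun x : ℝ => -x ^ 2 / 2) (-x) x := by
    exact ((hasDerivAt_pow 2 x).fun_neg.div_const 2).congr_deriv (by norm_num; ring)
  rw [funext phi_eq]
  exact (h.exp.const_mul _).congr_deriv (by ring)

theorem Phi_eq_integral (b : ℝ) : Phi b = ∫ t in Iic b, phi t := by
  rw [Phi, cdf_eq_real, Measure.real, gaussianReal_apply_eq_integral 0 one_ne_zero,
    ENNReal.toReal_ofReal
      (setIntegral_nonneg measurableSet_Iic fun t _ => gaussianPDFReal_nonneg 0 1 t)]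
  rfl

theorem hasDerivAt_Phi (b : ℝ) : HasDerivAt Phi (phi b) b := by
  have hint : Integrable phi := integrable_gaussianPDFReal 0 1
  have hcont : Continuous phi :=
    continuous_iff_continuousAt.2 fun x => (hasDerivAt_phi x).continuousAt
  have hPhi : Phi = fun x => Phi 0 + ∫ t in (0 : ℝ)..x, phi t := by
    funext x
    rw [← intervalIntegral.integral_Iic_sub_Iic hint.integrableOn hint.integrableOn,
      Phi_eq_integral, Phi_eq_integral, add_sub_cancel]
  rw [hPhi]
  exact (intervalIntegral.integral_hasDerivAt_right hint.intervalIntegrable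
    (hcont.stronglyMeasurableAtFilter _ _) hcont.continuousAt).const_add _

theorem tendsto_Phi_atBot : Tendsto Phi atBot (𝓝 0) := tendsto_cdf_atBot _

theorem strictMono_Phi : StrictMono Phi :=
  strictMono_of_hasDerivAt_pos hasDerivAt_Phi phi_pos

theorem Phi_pos (b : ℝ) : 0 < Phi b :=
  (cdf_nonneg _ (b - 1)).trans_lt (strictMono_Phi (sub_one_lt b))

theorem tendsto_add_mul_phi_atBot (c : ℝ) :
    Tendsto (fun t => (t + c) * phi t) atBot (𝓝 0) := by
  have hpow : ∀ r : ℝ, Tendsto (fun t => |t| ^ r * phi t) atBot (𝓝 0) := by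
    intro r
    have h := ((tendsto_rpow_abs_mul_exp_neg_mul_sq_cocompact one_half_pos r).mono_left
      atBot_le_cocompact).const_mul (√(2 * Real.pi))⁻¹
    rw [mul_zero] at h
    refine h.congr fun t => ?_
    rw [phi_eq, mul_left_comm]
    ring_nf
  have h := (hpow 0).const_mul c |>.sub (hpow 1)
  rw [mul_zero, sub_zero] at h
  refine h.congr' ?_
  filter_upwards [eventually_le_atBot 0] with t ht
  rw [Real.rpow_zero, Real.rpow_one, abs_of_nonpos ht]
  ring

/-- The difference of the two sides is `∫ t in Iic b, (t + c) ^ 2 * phi t`. -/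
theorem mul_phi_lt_mul_Phi (b c : ℝ) : (b + 2 * c) * phi b < (1 + c ^ 2) * Phi b := by
  have hderiv : ∀ t, HasDerivAt (fun t => (1 + c ^ 2) * Phi t - (t + 2 * c) * phi t)
      ((t + c) ^ 2 * phi t) t := fun t =>
    (((hasDerivAt_Phi t).const_mul _).sub
      (((hasDerivAt_id' t).add_const _).mul (hasDerivAt_phi t))).congr_deriv (by ring)
  have hmono := strictMono_of_hasDerivAt_pos_of_ne (-c) hderiv fun t ht =>
    mul_pos (pow_two_pos_of_ne_zero (by rwa [Ne, add_eq_zero_iff_eq_neg])) (phi_pos t)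
  have hlim := (tendsto_Phi_atBot.const_mul (1 + c ^ 2)).sub (tendsto_add_mul_phi_atBot (2 * c))
  rw [mul_zero, sub_zero] at hlim
  exact sub_pos.1 (lt_of_tendsto_atBot_of_strictMono hlim hmono b)

theorem invMills_pos (b : ℝ) : 0 < invMills b := div_pos (phi_pos b) (Phi_pos b)

theorem invMills_mul_add_lt_one (b : ℝ) : invMills b * (b + invMills b) < 1 := by
  have h := mul_phi_lt_mul_Phi b (invMills b)
  have hphi : phi b = invMills b * Phi b := (div_mul_cancel₀ _ (Phi_pos b).ne').symm
  rw [hphi, ← mul_assoc] at h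
  linarith [lt_of_mul_lt_mul_right h (Phi_pos b).le]

theorem hasDerivAt_add_invMills (b : ℝ) :
    HasDerivAt (fun b => b + invMills b) (1 - invMills b * (b + invMills b)) b := by
  refine ((hasDerivAt_id' b).add
    ((hasDerivAt_phi b).div (hasDerivAt_Phi b) (Phi_pos b).ne')).congr_deriv ?_
  have := (Phi_pos b).ne'
  unfold invMills
  field_simp
  ring

theorem strictMono_add_invMills : StrictMono fun b => b + invMills b :=
  strictMono_of_hasDerivAt_pos hasDerivAt_add_invMills fun b =>
    sub_pos.2 (invMills_mul_add_lt_one b)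

theorem exists_add_invMills_eq {γ : ℝ} (hγ : 0 < γ) : ∃ b, b + invMills b = γ := by
  have hcont : Continuous fun b => b + invMills b :=
    continuous_iff_continuousAt.2 fun b => (hasDerivAt_add_invMills b).continuousAt
  have hupper : γ ≤ γ + invMills γ := le_add_of_nonneg_right (invMills_pos γ).le
  have hlower : -γ⁻¹ + invMills (-γ⁻¹) ≤ γ := by
    have h := invMills_mul_add_lt_one (-γ⁻¹)
    have hsq := sq_nonneg (-γ⁻¹ + invMills (-γ⁻¹))
    have hlt : γ⁻¹ * (-γ⁻¹ + invMills (-γ⁻¹)) < 1 := by linarith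
    simpa using ((inv_mul_lt_iff₀ hγ).1 hlt).le
  exact mem_range_of_exists_le_of_exists_ge hcont ⟨_, hlower⟩ ⟨_, hupper⟩

theorem integral_Ioi_exp_mul_sub_sq (b : ℝ) :
    ∫ u in Ioi (0 : ℝ), Real.exp (b * u - u ^ 2 / 2) = (invMills b)⁻¹ := by
  have hPhi : ∫ u in Ioi (0 : ℝ), phi (b - u) = Phi b := by
    have hderiv : ∀ u ∈ Ici (0 : ℝ), HasDerivAt (fun u => -Phi (b - u)) (phi (b - u)) u := by
      intro u _
      have := ((hasDerivAt_Phi (b - u)).comp_const_sub b u).fun_neg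
      simpa using this
    have htop : Tendsto (fun u => -Phi (b - u)) atTop (𝓝 (-0)) :=
      (tendsto_Phi_atBot.comp (tendsto_atBot_add_const_left atTop b tendsto_neg_atTop_atBot)).neg
    rw [integral_Ioi_of_hasDerivAt_of_nonneg' hderiv (fun u _ => (phi_pos _).le) htop]
    simp
  have hexp : ∀ u, phi (b - u) = phi b * Real.exp (b * u - u ^ 2 / 2) := by
    intro u
    rw [phi_eq, phi_eq, mul_assoc, ← Real.exp_add]
    ring_nf
  simp only [hexp] at hPhi
  rw [integral_const_mul] at hPhi
  rw [invMills, inv_div, ← hPhi, mul_div_cancel_left₀ _ (phi_pos b).ne']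

end Gaussian

/-- The probability `p_s ⋯ p_{s+n-1}` that `n` successive customers, who find `s, …, s + n - 1`
customers in the system, are all admitted; the coefficient of `x ^ n` in `1 + F(x)`. -/
def admitProd (q : ℕ → ℝ) (n : ℕ) : ℝ := ∏ i ∈ Finset.range n, q i

section PolicySeries

variable {q : ℕ → ℝ}

theorem admitProd_nonneg (hq : ∀ n, q n ∈ Set.Icc (0 : ℝ) 1) (n : ℕ) : 0 ≤ admitProd q n :=
  Finset.prod_nonneg fun i _ => (hq i).1

theorem admitProd_le_one (hq : ∀ n, q n ∈ Set.Icc (0 : ℝ) 1) (n : ℕ) : admitProd q n ≤ 1 :=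
  Finset.prod_le_one (fun i _ => (hq i).1) fun i _ => (hq i).2

theorem isBoundedUnder_admitProd_rpow (hq : ∀ n, q n ∈ Set.Icc (0 : ℝ) 1) :
    IsBoundedUnder (· ≤ ·) atTop fun n : ℕ => admitProd q (n + 1) ^ (1 / ((n : ℝ) + 1)) :=
  isBoundedUnder_of ⟨1, fun _ =>
    Real.rpow_le_one (admitProd_nonneg hq _) (admitProd_le_one hq _) (by positivity)⟩

theorem policyP_nonneg (hq : ∀ n, q n ∈ Set.Icc (0 : ℝ) 1) : 0 ≤ policyP q :=
  le_limsup_of_frequently_le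
    (Frequently.of_forall fun _ => Real.rpow_nonneg (admitProd_nonneg hq _) _)
    (isBoundedUnder_admitProd_rpow hq)

theorem eventually_admitProd_succ_le_pow (hq : ∀ n, q n ∈ Set.Icc (0 : ℝ) 1) {ρ : ℝ}
    (hρ : policyP q < ρ) : ∀ᶠ n in atTop, admitProd q (n + 1) ≤ ρ ^ (n + 1) := by
  filter_upwards [eventually_lt_of_limsup_lt hρ (isBoundedUnder_admitProd_rpow hq)] with n hn
  have h0 := admitProd_nonneg hq (n + 1)
  rw [← Real.rpow_natCast]
  refine (Real.rpow_inv_le_iff_of_pos h0 ((policyP_nonneg hq).trans hρ.le) (by positivity)).1 ?_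
  rw [← one_div]
  exact_mod_cast hn.le

theorem summable_admitProd_mul_pow (hq : ∀ n, q n ∈ Set.Icc (0 : ℝ) 1) {x : ℝ} (hx : 0 ≤ x)
    (hxP : x * policyP q < 1) : Summable fun n => admitProd q n * x ^ n := by
  obtain ⟨ρ, hPρ, hxρ⟩ : ∃ ρ, policyP q < ρ ∧ x * ρ < 1 := by
    have h := ((continuous_const_mul x).tendsto (policyP q)).eventually_lt_const hxP
    exact h.exists_gt
  have hρ := (policyP_nonneg hq).trans hPρ.le
  rw [← summable_nat_add_iff 1]
  refine Summable.of_norm_bounded_eventually_nat (g := fun n => (x * ρ) ^ (n + 1))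
    ((summable_nat_add_iff 1).2 (summable_geometric_of_lt_one (by positivity) hxρ)) ?_
  filter_upwards [eventually_admitProd_succ_le_pow hq hPρ] with n hn
  have := admitProd_nonneg hq (n + 1)
  rw [Real.norm_of_nonneg (by positivity), mul_pow, mul_comm]
  gcongr

theorem tsum_admitProd_mul_pow {x : ℝ} (hs : Summable fun n => admitProd q n * x ^ n) :
    ∑' n, admitProd q n * x ^ n = 1 + policySeries q x := by
  rw [hs.tsum_eq_zero_add]
  simp [admitProd, policySeries]

theorem continuousOn_policySeries (hq : ∀ n, q n ∈ Set.Icc (0 : ℝ) 1) {R : ℝ} (hR : 0 ≤ R)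
    (hRP : R * policyP q < 1) : ContinuousOn (policySeries q) (Set.Icc 0 R) := by
  refine continuousOn_tsum (fun n => by fun_prop)
    ((summable_nat_add_iff 1).2 (summable_admitProd_mul_pow hq hR hRP)) fun n x hx => ?_
  have := admitProd_nonneg hq (n + 1)
  have hx0 := hx.1
  rw [← admitProd, Real.norm_of_nonneg (by positivity)]
  gcongr
  exact hx.2

theorem continuousAt_policySeries_one (hq : ∀ n, q n ∈ Set.Icc (0 : ℝ) 1) (hP : policyP q < 1) :
    ContinuousAt (policySeries q) 1 := by
  obtain ⟨R, h1R, hRP⟩ : ∃ R, 1 < R ∧ R * policyP q < 1 := by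
    have h := ((continuous_mul_const (policyP q)).tendsto 1).eventually_lt_const
      ((one_mul _).trans_lt hP)
    exact h.exists_gt
  exact (continuousOn_policySeries hq (zero_le_one.trans h1R.le) hRP).continuousAt
    (Icc_mem_nhds one_pos h1R)

theorem PolicyCondition.exists_le_policySeries (hF : PolicyCondition q) (C : ℝ) :
    ∃ R, 1 ≤ R ∧ R * policyP q < 1 ∧ C ≤ policySeries q R := by
  rcases hF.mem_Ico.1.eq_or_lt with hP | hP
  · obtain ⟨R, hC, hR⟩ := (((hF.tendsto_of_zero hP.symm).eventually_ge_atTop C).and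
      (eventually_ge_atTop 1)).exists
    exact ⟨R, hR, by simp [← hP], hC⟩
  · have h1R : ∀ᶠ R in 𝓝[<] (1 / policyP q), 1 < R :=
      nhdsWithin_le_nhds (lt_mem_nhds ((one_lt_div hP).2 hF.mem_Ico.2))
    obtain ⟨R, ⟨hC, hR⟩, hRP⟩ := ((((hF.tendsto_of_pos hP).eventually_ge_atTop C).and h1R).and
      self_mem_nhdsWithin).exists
    exact ⟨R, hR.le, (lt_div_iff₀ hP).1 hRP, hC⟩

end PolicySeries

section PowerSeriesDistribution

section OrderedRing

variable {R : Type*} [CommRing R] [LinearOrder R] [IsStrictOrderedRing R]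

theorem pow_mul_pow_le_pow_mul_pow {x y : R} (hx : 0 ≤ x) (hxy : x ≤ y) {i k : ℕ} (hik : i ≤ k) :
    y ^ i * x ^ k ≤ x ^ i * y ^ k := by
  obtain ⟨d, rfl⟩ := Nat.exists_eq_add_of_le hik
  have hy := hx.trans hxy
  calc y ^ i * x ^ (i + d) = y ^ i * x ^ i * x ^ d := by ring
    _ ≤ y ^ i * x ^ i * y ^ d := by gcongr
    _ = x ^ i * y ^ (i + d) := by ring

variable {c : ℕ → R} {x y : R} {m : ℕ}

theorem sum_range_mul_pow_mul_pow_le (hc : ∀ k, 0 ≤ c k) (hx : 0 ≤ x) (hxy : x ≤ y) {k : ℕ}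
    (hmk : m ≤ k) :
    (∑ i ∈ Finset.range m, c i * y ^ i) * x ^ k ≤ (∑ i ∈ Finset.range m, c i * x ^ i) * y ^ k := by
  simp only [Finset.sum_mul, mul_assoc]
  exact Finset.sum_le_sum fun i hi => mul_le_mul_of_nonneg_left
    (pow_mul_pow_le_pow_mul_pow hx hxy ((Finset.mem_range.1 hi).le.trans hmk)) (hc i)

theorem sum_range_mul_pow_mul_pow_lt (hc : ∀ k, 0 ≤ c k) (hc0 : 0 < c 0) (hx : 0 ≤ x)
    (hxy : x < y) (hm : 0 < m) {k : ℕ} (hmk : m ≤ k) :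
    (∑ i ∈ Finset.range m, c i * y ^ i) * x ^ k < (∑ i ∈ Finset.range m, c i * x ^ i) * y ^ k := by
  simp only [Finset.sum_mul, mul_assoc]
  refine Finset.sum_lt_sum (fun i hi => mul_le_mul_of_nonneg_left
    (pow_mul_pow_le_pow_mul_pow hx hxy.le ((Finset.mem_range.1 hi).le.trans hmk)) (hc i))
    ⟨0, Finset.mem_range.2 hm, ?_⟩
  simpa only [pow_zero, one_mul] using
    mul_lt_mul_of_pos_left (pow_lt_pow_left₀ hxy hx (hm.trans_le hmk).ne') hc0

end OrderedRing

variable {c : ℕ → ℝ} {x y : ℝ} {m : ℕ}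

/-- A random variable with weights `c k * x ^ k` is stochastically increasing in `x`. -/
theorem sum_range_mul_pow_div_tsum_lt (hc : ∀ k, 0 ≤ c k) (hc0 : 0 < c 0) (hx : 0 ≤ x)
    (hxy : x < y) (hs : Summable fun k => c k * y ^ k) (hm : 0 < m) {n : ℕ} (hmn : m ≤ n)
    (hcn : 0 < c n) :
    (∑ k ∈ Finset.range m, c k * y ^ k) / ∑' k, c k * y ^ k <
      (∑ k ∈ Finset.range m, c k * x ^ k) / ∑' k, c k * x ^ k := by
  have hnonneg : ∀ {z : ℝ}, 0 ≤ z → ∀ k, 0 ≤ c k * z ^ k := fun hz k =>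
    mul_nonneg (hc k) (pow_nonneg hz k)
  have hsx : Summable fun k => c k * x ^ k := hs.of_nonneg_of_le (hnonneg hx) fun k =>
    mul_le_mul_of_nonneg_left (pow_le_pow_left₀ hx hxy.le k) (hc k)
  have hpos : ∀ {z : ℝ}, 0 ≤ z → Summable (fun k => c k * z ^ k) → 0 < ∑' k, c k * z ^ k :=
    fun hz h => h.tsum_pos (hnonneg hz) 0 (by simpa using hc0)
  rw [div_lt_div_iff₀ (hpos (hx.trans hxy.le) hs) (hpos hx hsx), ← hsx.sum_add_tsum_nat_add m,
    ← hs.sum_add_tsum_nat_add m, mul_add, mul_add, mul_comm (∑ k ∈ _, c k * x ^ k)]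
  gcongr ?_ + ?_
  rw [← tsum_mul_left, ← tsum_mul_left]
  refine Summable.tsum_lt_tsum (i := n - m) (fun k => ?_) ?_
    (((summable_nat_add_iff m).2 hsx).mul_left _) (((summable_nat_add_iff m).2 hs).mul_left _)
  · simpa only [mul_left_comm] using mul_le_mul_of_nonneg_left
      (sum_range_mul_pow_mul_pow_le hc hx hxy.le (Nat.le_add_left m k)) (hc (k + m))
  · simpa only [Nat.sub_add_cancel hmn, mul_left_comm] using mul_lt_mul_of_pos_left
      (sum_range_mul_pow_mul_pow_lt hc hc0 hx hxy hm hmn) hcn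

end PowerSeriesDistribution

section Stationary

variable {q : ℕ → ℝ} {s : ℕ} {x : ℝ}

theorem admitProb_add (q : ℕ → ℝ) (s n : ℕ) : admitProb q s (s + n) = q n := by
  simp [admitProb]

theorem weight_zero (q : ℕ → ℝ) (s : ℕ) (x : ℝ) : weight q s x 0 = 1 := Finset.prod_range_zero _

theorem weight_eq_weight_one_mul_pow (q : ℕ → ℝ) (s : ℕ) (x : ℝ) (k : ℕ) :
    weight q s x k = weight q s 1 k * x ^ k := by
  simp only [weight, birthRate, mul_div_assoc, Finset.prod_mul_distrib, Finset.prod_const,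
    Finset.card_range, one_mul, mul_comm]

theorem weight_of_le {k : ℕ} (hks : k ≤ s) : weight q s x k = x ^ k / k.factorial := by
  induction k with
  | zero => simp [weight_zero]
  | succ k ih =>
    have hdeath : deathRate s (k + 1) = k + 1 := by
      rw [deathRate, min_eq_left hks, Nat.cast_succ]
    have hbirth : birthRate q s x k = x := by
      rw [birthRate, admitProb, if_pos (Nat.lt_of_succ_le hks), mul_one]
    have h := weight_succ (Nat.zero_lt_of_lt hks) q x k
    rw [ih (Nat.le_of_succ_le hks), hdeath, hbirth] at h
    rw [eq_div_iff (by positivity), Nat.factorial_succ, Nat.cast_mul, Nat.cast_succ, ← mul_assoc, h,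
      pow_succ]
    field_simp

theorem weight_add (hs : 0 < s) (n : ℕ) :
    weight q s x (s + n) = x ^ s / s.factorial * (admitProd q n * (x / s) ^ n) := by
  induction n with
  | zero => simp [weight_of_le le_rfl, admitProd]
  | succ n ih =>
    have hdeath : deathRate s (s + n + 1) = s := by
      rw [deathRate, min_eq_right (Nat.le_add_right_of_le (Nat.le_add_right s n))]
    have h := weight_succ hs q x (s + n)
    rw [ih, birthRate, admitProb_add, hdeath] at h
    have hs' : (s : ℝ) ≠ 0 := by positivity
    rw [← add_assoc, ← mul_left_inj' hs', h, admitProd, admitProd, Finset.prod_range_succ, pow_succ]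
    field_simp

theorem isStable_iff (hq : ∀ n, q n ∈ Set.Icc (0 : ℝ) 1) (hs : 0 < s) :
    IsStable q s x ↔ 0 ≤ x ∧ x / s * policyP q < 1 := by
  refine and_congr_right fun _ => ?_
  have hs' : (0 : ℝ) < s := Nat.cast_pos.2 hs
  rcases (policyP_nonneg hq).eq_or_lt with h | h
  · simp [← h]
  · rw [lt_div_iff₀ h, div_mul_eq_mul_div, div_lt_one hs']
    simp [h]

theorem IsStable.summable_admitProd (hq : ∀ n, q n ∈ Set.Icc (0 : ℝ) 1) (hs : 0 < s)
    (hx : IsStable q s x) : Summable fun n => admitProd q n * (x / s) ^ n :=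
  summable_admitProd_mul_pow hq (div_nonneg hx.1 s.cast_nonneg) ((isStable_iff hq hs).1 hx).2

theorem IsStable.summable_weight (hq : ∀ n, q n ∈ Set.Icc (0 : ℝ) 1) (hs : 0 < s)
    (hx : IsStable q s x) : Summable (weight q s x) := by
  rw [← summable_nat_add_iff s]
  simp only [add_comm _ s, weight_add hs]
  exact (hx.summable_admitProd hq hs).mul_left _

theorem tsum_weight_add (hq : ∀ n, q n ∈ Set.Icc (0 : ℝ) 1) (hs : 0 < s) (hx : IsStable q s x) :
    ∑' n, weight q s x (s + n) = x ^ s / s.factorial * (1 + policySeries q (x / s)) := by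
  simp only [weight_add hs, tsum_mul_left, tsum_admitProd_mul_pow (hx.summable_admitProd hq hs)]

theorem tsum_weight (hq : ∀ n, q n ∈ Set.Icc (0 : ℝ) 1) (hs : 0 < s) (hx : IsStable q s x) :
    ∑' k, weight q s x k = ∑ k ∈ Finset.range s, x ^ k / k.factorial +
      x ^ s / s.factorial * (1 + policySeries q (x / s)) := by
  rw [← (hx.summable_weight hq hs).sum_add_tsum_nat_add s, ← tsum_weight_add hq hs hx]
  simp only [add_comm _ s]
  rw [Finset.sum_congr rfl fun k hk => weight_of_le (Finset.mem_range.1 hk).le]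

theorem tsum_weight_pos (hq : ∀ n, q n ∈ Set.Icc (0 : ℝ) 1) (hs : 0 < s) (hx : IsStable q s x) :
    0 < ∑' k, weight q s x k :=
  (hx.summable_weight hq hs).tsum_pos (weight_nonneg hq s hx.1) 0
    (by rw [weight_zero]; exact one_pos)

theorem delayProb_eq (hq : ∀ n, q n ∈ Set.Icc (0 : ℝ) 1) (hs : 0 < s) (hx : IsStable q s x) :
    delayProb q s x =
      x ^ s / s.factorial * (1 + policySeries q (x / s)) / ∑' k, weight q s x k := by
  simp only [delayProb, stationaryDist, tsum_div_const, tsum_weight_add hq hs hx]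

theorem isStationary_stationaryDist (hq : ∀ n, q n ∈ Set.Icc (0 : ℝ) 1) (hs : 0 < s)
    (hx : IsStable q s x) : IsStationary q s x (stationaryDist q s x) :=
  (isStationary_iff hq hs hx.1 (hx.summable_weight hq hs) _).2 rfl

theorem rejectProb_nonneg (hq : ∀ n, q n ∈ Set.Icc (0 : ℝ) 1) (hx : 0 ≤ x) :
    0 ≤ rejectProb q s x :=
  tsum_nonneg fun n => mul_nonneg
    (div_nonneg (weight_nonneg hq s hx _) (tsum_nonneg (weight_nonneg hq s hx)))
    (by rw [admitProb_add]; exact sub_nonneg.2 (hq n).2)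

/-- The expected number of idle servers in the stationary regime. -/
def meanIdle (q : ℕ → ℝ) (s : ℕ) (x : ℝ) : ℝ :=
  ∑ k ∈ Finset.range s, ((s : ℝ) - k) * stationaryDist q s x k

theorem hasSum_stationaryDist_mul_deathRate (hq : ∀ n, q n ∈ Set.Icc (0 : ℝ) 1) (hs : 0 < s)
    (hx : IsStable q s x) :
    HasSum (fun k => stationaryDist q s x k * deathRate s k) (s - meanIdle q s x) := by
  have hidle : HasSum (fun k => (s - deathRate s k) * stationaryDist q s x k)
      (meanIdle q s x) := by
    have hrange : meanIdle q s x =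
        ∑ k ∈ Finset.range s, (s - deathRate s k) * stationaryDist q s x k :=
      Finset.sum_congr rfl fun k hk => by
        rw [deathRate, min_eq_left (Finset.mem_range.1 hk).le]
    rw [hrange]
    refine hasSum_sum_of_ne_finset_zero fun k hk => ?_
    rw [deathRate, min_eq_right (not_lt.1 (mt Finset.mem_range.2 hk)), sub_self, zero_mul]
  have hbusy := ((isStationary_stationaryDist hq hs hx).hasSum.mul_left (s : ℝ)).sub hidle
  rw [mul_one] at hbusy
  exact hbusy.congr_fun fun k => by ring

theorem hasSum_stationaryDist_mul_birthRate (hq : ∀ n, q n ∈ Set.Icc (0 : ℝ) 1) (hs : 0 < s)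
    (hx : IsStable q s x) :
    HasSum (fun k => stationaryDist q s x k * birthRate q s x k) (s - meanIdle q s x) := by
  have hbalance : ∀ k, stationaryDist q s x (k + 1) * deathRate s (k + 1) =
      stationaryDist q s x k * birthRate q s x k := fun k => by
    rw [stationaryDist, stationaryDist, div_mul_eq_mul_div, weight_succ hs, div_mul_eq_mul_div]
  have h := (hasSum_nat_add_iff' 1).2 (hasSum_stationaryDist_mul_deathRate hq hs hx)
  have hzero : deathRate s 0 = 0 := by simp [deathRate]
  simpa only [hbalance, Finset.sum_range_one, hzero, mul_zero, sub_zero] using h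

theorem mul_rejectProb_eq (hq : ∀ n, q n ∈ Set.Icc (0 : ℝ) 1) (hs : 0 < s) (hx : IsStable q s x) :
    x * rejectProb q s x = x - (s - meanIdle q s x) := by
  have h := ((isStationary_stationaryDist hq hs hx).hasSum.mul_left x).sub
    (hasSum_stationaryDist_mul_birthRate hq hs hx)
  rw [mul_one, ← hasSum_nat_add_iff' s, Finset.sum_eq_zero, sub_zero] at h
  · rw [← h.tsum_eq, rejectProb, ← tsum_mul_left]
    refine tsum_congr fun n => ?_
    rw [birthRate, add_comm n s]
    ring
  · intro k hk
    rw [birthRate, admitProb, if_pos (Finset.mem_range.1 hk)]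
    ring

end Stationary

section Cohen

variable {q : ℕ → ℝ} {s : ℕ}

theorem sum_range_sub_mul {R : Type*} [CommRing R] (s : ℕ) (a : ℕ → R) :
    ∑ k ∈ Finset.range s, ((s : R) - k) * a k =
      ∑ j ∈ Finset.range s, ∑ k ∈ Finset.range (j + 1), a k := by
  induction s with
  | zero => rfl
  | succ s ih =>
    rw [Finset.sum_range_succ (fun j => ∑ k ∈ Finset.range (j + 1), a k), ← ih,
      Finset.sum_range_succ, Finset.sum_range_succ a, ← add_assoc, ← Finset.sum_add_distrib]
    push_cast
    congr 1
    · exact Finset.sum_congr rfl fun k _ => by ring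
    · ring

theorem strictAntiOn_meanIdle (hq : ∀ n, q n ∈ Set.Icc (0 : ℝ) 1) (hs : 0 < s) :
    StrictAntiOn (meanIdle q s) {x | IsStable q s x} := by
  intro x hx y hy hxy
  simp only [meanIdle, sum_range_sub_mul]
  refine Finset.sum_lt_sum_of_nonempty (Finset.nonempty_range_iff.2 hs.ne') fun j hj => ?_
  have hsum := (hy.summable_weight hq hs).congr (weight_eq_weight_one_mul_pow q s y)
  simp only [stationaryDist, ← Finset.sum_div, weight_eq_weight_one_mul_pow q s x,
    weight_eq_weight_one_mul_pow q s y]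
  refine sum_range_mul_pow_div_tsum_lt (weight_nonneg hq s zero_le_one) ?_ hx.1 hxy hsum
    j.succ_pos (Nat.succ_le_of_lt (Finset.mem_range.1 hj)) ?_
  · rw [weight_zero]
    exact one_pos
  · rw [weight_of_le le_rfl]
    positivity

theorem meanIdle_eq_div_tsum (q : ℕ → ℝ) (s : ℕ) (x : ℝ) :
    meanIdle q s x =
      (∑ k ∈ Finset.range s, ((s : ℝ) - k) * (x ^ k / k.factorial)) / ∑' k, weight q s x k := by
  rw [meanIdle, Finset.sum_div]
  exact Finset.sum_congr rfl fun k hk => by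
    rw [stationaryDist, weight_of_le (Finset.mem_range.1 hk).le, mul_div_assoc]

theorem isCohenSolution_iff (hq : ∀ n, q n ∈ Set.Icc (0 : ℝ) 1) (hs : 0 < s) {lam Om : ℝ} :
    IsCohenSolution q s lam Om ↔
      IsStable q s (lam + Om) ∧ meanIdle q s (lam + Om) = s - lam := by
  constructor
  · intro h
    have hreject := mul_rejectProb_eq hq hs h.stable
    rw [← h.equation] at hreject
    exact ⟨h.stable, by linarith⟩
  · rintro ⟨hstable, hidle⟩
    have hOm : Om = (lam + Om) * rejectProb q s (lam + Om) := by
      rw [mul_rejectProb_eq hq hs hstable, hidle]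
      ring
    exact ⟨hOm ▸ mul_nonneg hstable.1 (rejectProb_nonneg hq hstable.1), hstable, hOm⟩

theorem isStable_of_le_mul (hq : ∀ n, q n ∈ Set.Icc (0 : ℝ) 1) (hs : 0 < s) {R : ℝ}
    (hRP : R * policyP q < 1) {x : ℝ} (hx : 0 ≤ x) (hxR : x ≤ s * R) : IsStable q s x :=
  (isStable_iff hq hs).2 ⟨hx, lt_of_le_of_lt (mul_le_mul_of_nonneg_right
    ((div_le_iff₀' (Nat.cast_pos.2 hs)).2 hxR) (policyP_nonneg hq)) hRP⟩

theorem continuousOn_meanIdle (hq : ∀ n, q n ∈ Set.Icc (0 : ℝ) 1) (hs : 0 < s) {R : ℝ}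
    (hR : 0 ≤ R) (hRP : R * policyP q < 1) :
    ContinuousOn (meanIdle q s) (Set.Icc 0 (s * R)) := by
  have hs' : (0 : ℝ) < s := Nat.cast_pos.2 hs
  have hstable : ∀ x ∈ Set.Icc 0 (s * R), IsStable q s x := fun x hx =>
    isStable_of_le_mul hq hs hRP hx.1 hx.2
  have hseries : ContinuousOn (fun x => policySeries q (x / s)) (Set.Icc 0 (s * R)) :=
    (continuousOn_policySeries hq hR hRP).comp (by fun_prop) fun x hx =>
      ⟨div_nonneg hx.1 hs'.le, (div_le_iff₀' hs').2 hx.2⟩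
  have htotal : ContinuousOn (fun x => ∑' k, weight q s x k) (Set.Icc 0 (s * R)) :=
    ContinuousOn.congr (by fun_prop) fun x hx => tsum_weight hq hs (hstable x hx)
  exact (ContinuousOn.div (by fun_prop) htotal fun x hx =>
    (tsum_weight_pos hq hs (hstable x hx)).ne').congr fun x _ => meanIdle_eq_div_tsum q s x

theorem sum_range_sub_mul_pow_div_factorial_le (s : ℕ) {x : ℝ} (hx : 1 ≤ x) :
    ∑ k ∈ Finset.range s, ((s : ℝ) - k) * (x ^ k / k.factorial) ≤ s * s * x ^ s := by
  have hterm : ∀ k ∈ Finset.range s, ((s : ℝ) - k) * (x ^ k / k.factorial) ≤ s * x ^ s := by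
    intro k hk
    have hks := (Finset.mem_range.1 hk).le
    have hfact : (1 : ℝ) ≤ k.factorial := Nat.one_le_cast.2 k.factorial_pos
    gcongr
    · exact sub_le_self _ k.cast_nonneg
    · exact (div_le_self (by positivity) hfact).trans (pow_le_pow_right₀ hx hks)
  simpa [mul_assoc] using Finset.sum_le_card_nsmul _ _ _ hterm

theorem meanIdle_le_of_le_policySeries (hq : ∀ n, q n ∈ Set.Icc (0 : ℝ) 1) (hs : 0 < s) {R c : ℝ}
    (hR : 1 ≤ R) (hRP : R * policyP q < 1) (hc : 0 < c)
    (hF : s.factorial * s * s / c ≤ policySeries q R) : meanIdle q s (s * R) ≤ c := by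
  have hs' : (1 : ℝ) ≤ s := Nat.one_le_cast.2 hs
  have hstable : IsStable q s (s * R) := isStable_of_le_mul hq hs hRP (by positivity) le_rfl
  rw [div_le_iff₀ hc] at hF
  rw [meanIdle_eq_div_tsum, div_le_iff₀ (tsum_weight_pos hq hs hstable), tsum_weight hq hs hstable,
    mul_div_cancel_left₀ R (by positivity)]
  calc ∑ k ∈ Finset.range s, ((s : ℝ) - k) * ((s * R) ^ k / k.factorial)
      ≤ s * s * (s * R) ^ s :=
        sum_range_sub_mul_pow_div_factorial_le s (one_le_mul_of_one_le_of_one_le hs' hR)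
    _ = (s * R) ^ s / s.factorial * (s.factorial * s * s) := by field_simp
    _ ≤ (s * R) ^ s / s.factorial * (policySeries q R * c) := by gcongr
    _ ≤ c * (∑ k ∈ Finset.range s, (s * R) ^ k / k.factorial +
          (s * R) ^ s / s.factorial * (1 + policySeries q R)) := by
        have : 0 ≤ c * (∑ k ∈ Finset.range s, (s * R) ^ k / k.factorial +
          (s * R) ^ s / s.factorial) := by positivity
        linarith

theorem meanIdle_zero (q : ℕ → ℝ) (hs : 0 < s) : meanIdle q s 0 = s := by
  have hweight : ∀ k ≠ 0, weight q s 0 k = 0 := fun k hk => by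
    rw [weight_eq_weight_one_mul_pow, zero_pow hk, mul_zero]
  rw [meanIdle, Finset.sum_eq_single_of_mem 0 (Finset.mem_range.2 hs) fun k _ hk => by
    rw [stationaryDist, hweight k hk, zero_div, mul_zero]]
  simp [stationaryDist, tsum_eq_single 0 hweight, weight_zero]

theorem existsUnique_isCohenSolution (hq : ∀ n, q n ∈ Set.Icc (0 : ℝ) 1) (hF : PolicyCondition q)
    (hs : 0 < s) {lam : ℝ} (hlam : 0 ≤ lam) (hlams : lam < s) :
    ∃! Om, IsCohenSolution q s lam Om := by
  simp only [isCohenSolution_iff hq hs]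
  obtain ⟨R, hR, hRP, hFR⟩ := hF.exists_le_policySeries (s.factorial * s * s / (s - lam))
  obtain ⟨x, hx, hxlam⟩ : s - lam ∈ meanIdle q s '' Set.Icc 0 (s * R) :=
    intermediate_value_Icc' (by positivity)
      (continuousOn_meanIdle hq hs (zero_le_one.trans hR) hRP)
      ⟨meanIdle_le_of_le_policySeries hq hs hR hRP (sub_pos.2 hlams) hFR,
        by rw [meanIdle_zero q hs]; exact sub_le_self _ hlam⟩
  have hxstable : IsStable q s x := isStable_of_le_mul hq hs hRP hx.1 hx.2
  refine ⟨x - lam, by simpa using ⟨hxstable, hxlam⟩, fun Om ⟨hstable, hidle⟩ => ?_⟩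
  exact eq_sub_of_add_eq' ((strictAntiOn_meanIdle hq hs).injOn hstable hxstable
    (hidle.trans hxlam.symm))

end Cohen

section Erlang

open MeasureTheory Set

/-- The odds that an arriving customer finds an idle server in Erlang's loss system, where
customers who find all `s` servers occupied are rejected; `1 / (1 + erlangOdds s x)` is the Erlang
loss probability. -/
def erlangOdds (s : ℕ) (x : ℝ) : ℝ :=
  (∑ k ∈ Finset.range s, x ^ k / k.factorial) / (x ^ s / s.factorial)

theorem erlangOdds_mul (s : ℕ) {x : ℝ} (hx : x ≠ 0) :
    erlangOdds s x * (x ^ s / s.factorial) = ∑ k ∈ Finset.range s, x ^ k / k.factorial :=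
  div_mul_cancel₀ _ (by positivity)

theorem sum_range_sub_mul_pow_div_factorial (s : ℕ) (x : ℝ) :
    ∑ k ∈ Finset.range s, ((s : ℝ) - k) * (x ^ k / k.factorial) =
      (s - x) * ∑ k ∈ Finset.range s, x ^ k / k.factorial + s * (x ^ s / s.factorial) := by
  induction s with
  | zero => simp
  | succ s ih =>
    have hfact : ((s + 1 : ℕ) : ℝ) * (x ^ (s + 1) / (s + 1).factorial) =
        x * (x ^ s / s.factorial) := by
      rw [Nat.factorial_succ, pow_succ]
      push_cast
      field_simp
    rw [sum_range_sub_mul, Finset.sum_range_succ, ← sum_range_sub_mul, ih, hfact,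
      Finset.sum_range_succ]
    push_cast
    ring

theorem meanIdle_eq {q : ℕ → ℝ} (hq : ∀ n, q n ∈ Icc (0 : ℝ) 1) {s : ℕ} (hs : 0 < s) {x : ℝ}
    (hx : 0 < x) (hstable : IsStable q s x) :
    meanIdle q s x = ((s - x) * erlangOdds s x + s) /
      (erlangOdds s x + (1 + policySeries q (x / s))) := by
  have hterm : x ^ s / s.factorial ≠ 0 := by positivity
  rw [meanIdle_eq_div_tsum, tsum_weight hq hs hstable, sum_range_sub_mul_pow_div_factorial,
    ← erlangOdds_mul s hx.ne']
  convert mul_div_mul_right _ _ hterm using 2 <;> ring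

theorem delayProb_eq_div {q : ℕ → ℝ} (hq : ∀ n, q n ∈ Icc (0 : ℝ) 1) {s : ℕ} (hs : 0 < s) {x : ℝ}
    (hx : 0 < x) (hstable : IsStable q s x) :
    delayProb q s x = (1 + policySeries q (x / s)) /
      (erlangOdds s x + (1 + policySeries q (x / s))) := by
  have hterm : x ^ s / s.factorial ≠ 0 := by positivity
  rw [delayProb_eq hq hs hstable, tsum_weight hq hs hstable, ← erlangOdds_mul s hx.ne']
  convert mul_div_mul_right _ _ hterm using 2 <;> ring

theorem erlangOdds_add_one (s : ℕ) {x : ℝ} (hx : x ≠ 0) :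
    erlangOdds s x + 1 = ∑ j ∈ Finset.range (s + 1), (s.descFactorial j : ℝ) / x ^ j := by
  have hterm : x ^ s / s.factorial ≠ 0 := by positivity
  rw [← mul_left_inj' hterm, add_one_mul, erlangOdds_mul s hx, ← Finset.sum_range_succ,
    ← Finset.sum_flip, Finset.sum_mul]
  refine Finset.sum_congr rfl fun j hj => ?_
  obtain ⟨d, rfl⟩ := Nat.exists_eq_add_of_le' (Finset.mem_range_succ_iff.1 hj)
  rw [Nat.add_sub_cancel, ← Nat.factorial_mul_descFactorial (Nat.le_add_left j d),
    Nat.add_sub_cancel, pow_add]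
  push_cast
  field_simp

theorem integral_pow_mul_exp_neg_mul_Ioi (n : ℕ) {r : ℝ} (hr : 0 < r) :
    ∫ t in Ioi (0 : ℝ), t ^ n * Real.exp (-(r * t)) = n.factorial / r ^ (n + 1) := by
  have h := Real.integral_rpow_mul_exp_neg_mul_Ioi (a := n + 1) (by positivity) hr
  rw [Real.Gamma_nat_eq_factorial, ← Nat.cast_succ, Real.rpow_natCast, one_div, inv_pow,
    inv_mul_eq_div] at h
  simpa using h

theorem integrableOn_pow_mul_exp_neg_mul_Ioi (n : ℕ) {r : ℝ} (hr : 0 < r) :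
    IntegrableOn (fun t : ℝ => t ^ n * Real.exp (-(r * t))) (Ioi 0) :=
  .of_integral_ne_zero (by rw [integral_pow_mul_exp_neg_mul_Ioi n hr]; positivity)

theorem integral_one_add_div_pow_mul_exp_neg (s : ℕ) {x c : ℝ} (hx : 0 < x) (hc : 0 < c) :
    ∫ u in Ioi (0 : ℝ), (1 + u / c) ^ s * Real.exp (-(x / c * u)) =
      c / x * (erlangOdds s x + 1) := by
  have hexpand : ∀ u : ℝ, (1 + u / c) ^ s * Real.exp (-(x / c * u)) =
      ∑ j ∈ Finset.range (s + 1), s.choose j / c ^ j * (u ^ j * Real.exp (-(x / c * u))) := by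
    intro u
    rw [add_comm, add_pow, Finset.sum_mul]
    exact Finset.sum_congr rfl fun j _ => by rw [one_pow, div_pow]; ring
  simp only [hexpand]
  rw [integral_finsetSum _ fun j _ =>
      (integrableOn_pow_mul_exp_neg_mul_Ioi j (div_pos hx hc)).const_mul _,
    erlangOdds_add_one s hx.ne', Finset.mul_sum]
  refine Finset.sum_congr rfl fun j _ => ?_
  rw [integral_const_mul, integral_pow_mul_exp_neg_mul_Ioi j (div_pos hx hc),
    Nat.descFactorial_eq_factorial_mul_choose, Nat.cast_mul, div_pow x c]
  field_simp
  ring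

end Erlang

section Laplace

open MeasureTheory Set

theorem log_le_sub_inv_div_two {y : ℝ} (hy : 1 ≤ y) : Real.log y ≤ (y - y⁻¹) / 2 := by
  rw [← Real.sinh_log (by positivity)]
  exact Real.self_le_sinh_iff.2 (Real.log_nonneg hy)

theorem sq_mul_log_sub_le {c u : ℝ} (hc : 0 < c) (hu : 0 ≤ u) :
    c ^ 2 * Real.log (1 + u / c) - c * u ≤ -(u ^ 2 / (2 * (1 + u / c))) := by
  have huc : 0 ≤ u / c := by positivity
  calc c ^ 2 * Real.log (1 + u / c) - c * u
      ≤ c ^ 2 * ((1 + u / c - (1 + u / c)⁻¹) / 2) - c * u := by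
        gcongr
        exact log_le_sub_inv_div_two (by linarith)
    _ = -(u ^ 2 / (2 * (1 + u / c))) := by
        have hcu : c + u ≠ 0 := by positivity
        field_simp
        ring

theorem le_sq_mul_log_sub {c u : ℝ} (hc : 0 < c) (hu : 0 ≤ u) :
    -(u ^ 2 / (u / c + 2)) ≤ c ^ 2 * Real.log (1 + u / c) - c * u := by
  have huc : 0 ≤ u / c := by positivity
  calc -(u ^ 2 / (u / c + 2))
      = c ^ 2 * (2 * (u / c) / (u / c + 2)) - c * u := by
        field_simp
        ring
    _ ≤ c ^ 2 * Real.log (1 + u / c) - c * u := by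
        gcongr
        exact Real.le_log_one_add_of_nonneg huc

theorem tendsto_sq_mul_log_sub {u : ℝ} (hu : 0 ≤ u) :
    Tendsto (fun c : ℝ => c ^ 2 * Real.log (1 + u / c) - c * u) atTop (𝓝 (-(u ^ 2 / 2))) := by
  have hdiv : Tendsto (fun c : ℝ => u / c) atTop (𝓝 0) := tendsto_const_nhds.div_atTop tendsto_id
  have hlower : Tendsto (fun c : ℝ => -(u ^ 2 / (u / c + 2))) atTop (𝓝 (-(u ^ 2 / 2))) := by
    simpa using ((tendsto_const_nhds (x := u ^ 2)).div (hdiv.add_const 2) (by norm_num)).neg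
  have hupper : Tendsto (fun c : ℝ => -(u ^ 2 / (2 * (1 + u / c)))) atTop
      (𝓝 (-(u ^ 2 / 2))) := by
    simpa using
      ((tendsto_const_nhds (x := u ^ 2)).div ((hdiv.const_add 1).const_mul 2) (by norm_num)).neg
  refine tendsto_of_tendsto_of_tendsto_of_le_of_le' hlower hupper ?_ ?_
  · filter_upwards [eventually_gt_atTop 0] with c hc using le_sq_mul_log_sub hc hu
  · filter_upwards [eventually_gt_atTop 0] with c hc using sq_mul_log_sub_le hc hu

theorem sq_mul_log_sub_le_of_le {c u K : ℝ} (hK : 0 < K) (hKc : K ≤ c) (hu : 0 ≤ u) :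
    c ^ 2 * Real.log (1 + u / c) - c * u ≤ K ^ 2 / 2 - K / 2 * u := by
  have hc : 0 < c := hK.trans_le hKc
  refine (sq_mul_log_sub_le hc hu).trans ?_
  calc -(u ^ 2 / (2 * (1 + u / c))) ≤ -(u ^ 2 / (2 * (1 + u / K))) := by gcongr
    _ ≤ -((u ^ 2 - K ^ 2) / (2 * (1 + u / K))) := by
        gcongr
        exact sub_le_self _ (sq_nonneg K)
    _ = K ^ 2 / 2 - K / 2 * u := by
        have hKu : K + u ≠ 0 := by positivity
        field_simp
        ring

theorem tendsto_integral_exp_mul_add_sq_mul_log_sub {ι : Type*} {l : Filter ι}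
    [l.IsCountablyGenerated] {b c : ι → ℝ} {β : ℝ} (hb : Tendsto b l (𝓝 β))
    (hc : Tendsto c l atTop) :
    Tendsto (fun i => ∫ u in Ioi (0 : ℝ),
      Real.exp (b i * u + (c i ^ 2 * Real.log (1 + u / c i) - c i * u))) l
      (𝓝 (invMills β)⁻¹) := by
  rw [← integral_Ioi_exp_mul_sub_sq]
  -- once `b i ≤ |β| + 1`, the exponent is at most `K ^ 2 / 2 - u`
  let K := 2 * (|β| + 2)
  have hKpos : 0 < K := by positivity
  refine tendsto_integral_filter_of_dominated_convergence
    (fun u => Real.exp (K ^ 2 / 2) * Real.exp (-u)) ?_ ?_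
    ((integrableOn_exp_neg_Ioi 0).const_mul _) ?_
  · exact .of_forall fun i => Measurable.aestronglyMeasurable (by fun_prop)
  · filter_upwards [hc.eventually_ge_atTop K,
      hb.eventually_lt_const (lt_add_of_le_of_pos (le_abs_self β) one_pos)] with i hci hbi
    filter_upwards [ae_restrict_mem measurableSet_Ioi] with u hu
    rw [Real.norm_eq_abs, Real.abs_exp, ← Real.exp_add, Real.exp_le_exp]
    linarith [show K = 2 * (|β| + 2) from rfl, sq_mul_log_sub_le_of_le hKpos hci (le_of_lt hu),
      mul_le_mul_of_nonneg_right hbi.le (le_of_lt hu)]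
  · filter_upwards [ae_restrict_mem measurableSet_Ioi] with u hu
    rw [sub_eq_add_neg (β * u)]
    exact (Real.continuous_exp.tendsto _).comp
      ((hb.mul_const u).add ((tendsto_sq_mul_log_sub (le_of_lt hu)).comp hc))

end Laplace

section QED

open MeasureTheory Set

/-- Square-root staffing (the Halfin–Whitt or QED regime): with `s` servers the arrival rate is
`s - β * √s + o(√s)`. -/
def IsQED (β : ℝ) (x : ℕ → ℝ) : Prop :=
  Tendsto (fun s : ℕ => (s - x s) / √(s : ℝ)) atTop (𝓝 β)

theorem tendsto_sqrt_natCast_atTop : Tendsto (fun s : ℕ => √(s : ℝ)) atTop atTop :=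
  Real.tendsto_sqrt_atTop.comp tendsto_natCast_atTop_atTop

theorem isQED_sub_mul_sqrt (β : ℝ) : IsQED β fun s => s - β * √(s : ℝ) := by
  refine tendsto_const_nhds.congr' ?_
  filter_upwards [eventually_gt_atTop 0] with s hs
  rw [sub_sub_cancel, mul_div_cancel_right₀ _ (by positivity)]

variable {q : ℕ → ℝ} {β : ℝ} {x : ℕ → ℝ}

theorem IsQED.tendsto_div (hx : IsQED β x) : Tendsto (fun s => x s / s) atTop (𝓝 1) := by
  have h : Tendsto (fun s => 1 - (s - x s) / √(s : ℝ) * (√(s : ℝ))⁻¹) atTop (𝓝 (1 - β * 0)) :=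
    (hx.mul tendsto_sqrt_natCast_atTop.inv_tendsto_atTop).const_sub 1
  rw [mul_zero, sub_zero] at h
  refine h.congr' ?_
  filter_upwards [eventually_gt_atTop 0] with s hs
  have hs' : (0 : ℝ) < s := Nat.cast_pos.2 hs
  rw [← div_eq_mul_inv, div_div, Real.mul_self_sqrt hs'.le, sub_div, div_self hs'.ne',
    sub_sub_cancel]

theorem IsQED.eventually_pos (hx : IsQED β x) : ∀ᶠ s in atTop, 0 < x s := by
  filter_upwards [eventually_gt_atTop 0, hx.tendsto_div.eventually_const_lt one_pos] with s hs hxs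
  exact (div_pos_iff_of_pos_right (Nat.cast_pos.2 hs)).1 hxs

theorem IsQED.eventually_isStable (hx : IsQED β x) (hq : ∀ n, q n ∈ Icc (0 : ℝ) 1)
    (hP : policyP q < 1) : ∀ᶠ s in atTop, IsStable q s (x s) := by
  have hload : Tendsto (fun s => x s / s * policyP q) atTop (𝓝 (policyP q)) := by
    simpa using hx.tendsto_div.mul_const (policyP q)
  filter_upwards [eventually_gt_atTop 0, hx.eventually_pos, hload.eventually_lt_const hP]
    with s hs hxs hlt using (isStable_iff hq hs).2 ⟨hxs.le, hlt⟩

theorem IsQED.tendsto_erlangOdds_div_sqrt (hx : IsQED β x) :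
    Tendsto (fun s => erlangOdds s (x s) / √(s : ℝ)) atTop (𝓝 (invMills β)⁻¹) := by
  have hintegral :=
    tendsto_integral_exp_mul_add_sq_mul_log_sub hx tendsto_sqrt_natCast_atTop
  have h := (hx.tendsto_div.mul hintegral).sub tendsto_sqrt_natCast_atTop.inv_tendsto_atTop
  rw [one_mul, sub_zero] at h
  refine h.congr' ?_
  filter_upwards [eventually_gt_atTop 0, hx.eventually_pos] with s hs hxs
  have hsqrt : 0 < √(s : ℝ) := by positivity
  have hsq : √(s : ℝ) ^ 2 = s := Real.sq_sqrt s.cast_nonneg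
  have hintegrand : ∀ u ∈ Ioi (0 : ℝ),
      Real.exp ((s - x s) / √(s : ℝ) * u +
          (√(s : ℝ) ^ 2 * Real.log (1 + u / √(s : ℝ)) - √(s : ℝ) * u)) =
        (1 + u / √(s : ℝ)) ^ s * Real.exp (-(x s / √(s : ℝ) * u)) := by
    intro u hu
    have hpos : 0 < 1 + u / √(s : ℝ) := add_pos one_pos (div_pos hu hsqrt)
    rw [← Real.exp_log (pow_pos hpos s), Real.log_pow, ← Real.exp_add, hsq, sub_div,
      Real.div_sqrt]
    ring_nf
  rw [setIntegral_congr_fun measurableSet_Ioi hintegrand,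
    integral_one_add_div_pow_mul_exp_neg s hxs hsqrt, Pi.inv_apply]
  field_simp
  rw [hsq]
  ring

theorem IsQED.tendsto_policySeries (hx : IsQED β x) (hq : ∀ n, q n ∈ Icc (0 : ℝ) 1)
    (hP : policyP q < 1) :
    Tendsto (fun s => policySeries q (x s / s)) atTop (𝓝 (policySeries q 1)) :=
  (continuousAt_policySeries_one hq hP).tendsto.comp hx.tendsto_div

theorem IsQED.tendsto_erlangOdds_add_policySeries_div_sqrt (hx : IsQED β x)
    (hq : ∀ n, q n ∈ Icc (0 : ℝ) 1) (hP : policyP q < 1) :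
    Tendsto (fun s => (erlangOdds s (x s) + (1 + policySeries q (x s / s))) / √(s : ℝ)) atTop
      (𝓝 (invMills β)⁻¹) := by
  simpa only [add_div, add_zero] using hx.tendsto_erlangOdds_div_sqrt.add
    (((hx.tendsto_policySeries hq hP).const_add 1).div_atTop tendsto_sqrt_natCast_atTop)

theorem IsQED.tendsto_delayProb (hx : IsQED β x) (hq : ∀ n, q n ∈ Icc (0 : ℝ) 1)
    (hP : policyP q < 1) :
    Tendsto (fun s : ℕ => √(s : ℝ) * delayProb q s (x s)) atTop
      (𝓝 ((1 + policySeries q 1) * invMills β)) := by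
  have h := ((hx.tendsto_policySeries hq hP).const_add 1).div
    (hx.tendsto_erlangOdds_add_policySeries_div_sqrt hq hP) (inv_ne_zero (invMills_pos β).ne')
  rw [div_inv_eq_mul] at h
  refine h.congr' ?_
  filter_upwards [eventually_gt_atTop 0, hx.eventually_pos, hx.eventually_isStable hq hP]
    with s hs hxs hstable
  rw [delayProb_eq_div hq hs hxs hstable, Pi.div_apply, div_div_eq_mul_div, mul_comm, mul_div_assoc]

theorem IsQED.tendsto_meanIdle_div_sqrt (hx : IsQED β x) (hq : ∀ n, q n ∈ Icc (0 : ℝ) 1)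
    (hP : policyP q < 1) :
    Tendsto (fun s => meanIdle q s (x s) / √(s : ℝ)) atTop (𝓝 (β + invMills β)) := by
  have hlimit : (β * (invMills β)⁻¹ + 1) / (invMills β)⁻¹ = β + invMills β := by
    have := invMills_pos β
    field_simp
  rw [← hlimit]
  refine (((hx.mul hx.tendsto_erlangOdds_div_sqrt).add_const 1).div
    (hx.tendsto_erlangOdds_add_policySeries_div_sqrt hq hP)
    (inv_ne_zero (invMills_pos β).ne')).congr' ?_
  filter_upwards [eventually_gt_atTop 0, hx.eventually_pos, hx.eventually_isStable hq hP]
    with s hs hxs hstable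
  have hsqrt : √(s : ℝ) ≠ 0 := by positivity
  have hsq : √(s : ℝ) ^ 2 = s := Real.sq_sqrt s.cast_nonneg
  rw [meanIdle_eq hq hs hxs hstable, Pi.div_apply, div_div_eq_mul_div, div_right_comm _ _ √(s : ℝ)]
  congr 1
  field_simp
  rw [hsq]

theorem IsQED.tendsto_rejectProb (hx : IsQED β x) (hq : ∀ n, q n ∈ Icc (0 : ℝ) 1)
    (hP : policyP q < 1) :
    Tendsto (fun s : ℕ => √(s : ℝ) * rejectProb q s (x s)) atTop (𝓝 (invMills β)) := by
  have h := ((hx.tendsto_meanIdle_div_sqrt hq hP).sub hx).div hx.tendsto_div one_ne_zero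
  rw [add_sub_cancel_left, div_one] at h
  refine h.congr' ?_
  filter_upwards [eventually_gt_atTop 0, hx.eventually_pos, hx.eventually_isStable hq hP]
    with s hs hxs hstable
  have hreject : meanIdle q s (x s) - (s - x s) = x s * rejectProb q s (x s) := by
    rw [mul_rejectProb_eq hq hs hstable]
    ring
  have hsqrt : √(s : ℝ) ≠ 0 := by positivity
  rw [Pi.div_apply, ← sub_div, hreject]
  field_simp
  rw [Real.sq_sqrt s.cast_nonneg]

variable {γ : ℝ} {lam Om : ℕ → ℝ}

/-- Since `meanIdle` is decreasing in the arrival rate, comparing `lam s + Om s` with the staffing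
rule `s - b * √s` amounts to comparing `γ` with the limit `b + invMills b` of the scaled number of
idle servers. -/
theorem IsQED.add_cohenSolution (hlam : IsQED γ lam) (hq : ∀ n, q n ∈ Icc (0 : ℝ) 1)
    (hP : policyP q < 1) (hOm : ∀ᶠ s in atTop, IsCohenSolution q s (lam s) (Om s))
    (hβ : β + invMills β = γ) : IsQED β fun s => lam s + Om s := by
  have hidle : Tendsto (fun s => meanIdle q s (lam s + Om s) / √(s : ℝ)) atTop (𝓝 γ) :=
    hlam.congr' <| by
      filter_upwards [eventually_gt_atTop 0, hOm] with s hs hsol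
      rw [((isCohenSolution_iff hq hs).1 hsol).2]
  have hcompare : ∀ b, ∀ᶠ s : ℕ in atTop,
      (meanIdle q s (s - b * √(s : ℝ)) / √(s : ℝ) < meanIdle q s (lam s + Om s) / √(s : ℝ) ↔
        b < (s - (lam s + Om s)) / √(s : ℝ)) ∧
      (meanIdle q s (lam s + Om s) / √(s : ℝ) < meanIdle q s (s - b * √(s : ℝ)) / √(s : ℝ) ↔
        (s - (lam s + Om s)) / √(s : ℝ) < b) := by
    intro b
    filter_upwards [eventually_gt_atTop 0, hOm,
      (isQED_sub_mul_sqrt b).eventually_isStable hq hP] with s hs hsol hstable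
    have hsqrt : 0 < √(s : ℝ) := by positivity
    have hanti := strictAntiOn_meanIdle hq hs
    rw [div_lt_div_iff_of_pos_right hsqrt, div_lt_div_iff_of_pos_right hsqrt,
      hanti.lt_iff_gt hstable hsol.stable, hanti.lt_iff_gt hsol.stable hstable,
      lt_div_iff₀ hsqrt, div_lt_iff₀ hsqrt, lt_sub_comm, sub_lt_comm]
    exact ⟨Iff.rfl, Iff.rfl⟩
  have hlimit := fun b => (isQED_sub_mul_sqrt b).tendsto_meanIdle_div_sqrt hq hP
  rw [← hβ] at hidle
  refine tendsto_order.2 ⟨fun b hb => ?_, fun b hb => ?_⟩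
  · filter_upwards [(hlimit b).eventually_lt hidle (strictMono_add_invMills hb), hcompare b]
      with s hlt h using h.1.1 hlt
  · filter_upwards [hidle.eventually_lt (hlimit b) (strictMono_add_invMills hb), hcompare b]
      with s hlt h using h.2.1 hlt

theorem IsQED.tendsto_sub_div_sqrt (hlam : IsQED γ lam) (hx : IsQED β fun s => lam s + Om s) :
    Tendsto (fun s => Om s / √(s : ℝ)) atTop (𝓝 (γ - β)) := by
  refine (hlam.sub hx).congr fun s => ?_
  rw [← sub_div]
  ring

theorem sub_mul_sqrt_mem_Ico {s : ℕ} (hγ : 0 < γ) (hγs : γ ≤ √(s : ℝ)) :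
    s - γ * √(s : ℝ) ∈ Ico (0 : ℝ) s := by
  have hsqrt : 0 < √(s : ℝ) := hγ.trans_le hγs
  refine ⟨sub_nonneg.2 ?_, sub_lt_self _ (mul_pos hγ hsqrt)⟩
  calc γ * √(s : ℝ) ≤ √(s : ℝ) * √(s : ℝ) := mul_le_mul_of_nonneg_right hγs hsqrt.le
    _ = s := Real.mul_self_sqrt s.cast_nonneg

end QED

end RetrialQueue

end

open RetrialQueue in
theorem mainTheorem2_general (q : ℕ → ℝ) (hq : ∀ n, q n ∈ Set.Icc (0 : ℝ) 1)
    (hF : PolicyCondition q) (γ : ℝ) (hγ : 0 < γ) :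
    (∀ (s : ℕ) (lam : ℝ), 0 ≤ lam → lam < s → ∃! Om : ℝ, IsCohenSolution q s lam Om) ∧
    ∃ a : ℝ, (0 < a ∧ a = phi (γ - a) / Phi (γ - a)) ∧
      (∀ b : ℝ, b = phi (γ - b) / Phi (γ - b) → b = a) ∧
      ∀ lam Om : ℕ → ℝ, IsQED γ lam →
        (∀ᶠ s : ℕ in atTop, IsCohenSolution q s (lam s) (Om s)) →
        Tendsto (fun s : ℕ => Om s / √(s : ℝ)) atTop (𝓝 a) ∧
        Tendsto (fun s : ℕ => √(s : ℝ) * delayProb q s (lam s + Om s)) atTop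
          (𝓝 ((1 + policySeries q 1) * (phi (γ - a) / Phi (γ - a)))) ∧
        Tendsto (fun s : ℕ => √(s : ℝ) * rejectProb q s (lam s + Om s)) atTop
          (𝓝 (phi (γ - a) / Phi (γ - a))) := by
  obtain ⟨β, rfl⟩ := exists_add_invMills_eq hγ
  refine ⟨fun s lam h0 hs => existsUnique_isCohenSolution hq hF
    (Nat.cast_pos.1 (h0.trans_lt hs)) h0 hs, invMills β, ?_⟩
  rw [add_sub_cancel_right]
  refine ⟨⟨invMills_pos β, rfl⟩, fun b hb => ?_, fun lam Om hlam hOm => ?_⟩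
  · have h : β + invMills β - b = β := strictMono_add_invMills.injective <| by
      rw [← invMills] at hb
      rw [← hb, sub_add_cancel]
    rw [hb, h, invMills]
  · have hP := hF.mem_Ico.2
    have hx := hlam.add_cohenSolution hq hP hOm rfl
    exact ⟨by simpa using hlam.tendsto_sub_div_sqrt hx, hx.tendsto_delayProb hq hP,
      hx.tendsto_rejectProb hq hP⟩

open RetrialQueue in
theorem mainTheorem2 (q : ℕ → ℝ) (hq : ∀ n, q n ∈ Set.Icc (0 : ℝ) 1) (hF : PolicyCondition q)
    (γ : ℝ) (hγ : 0 < γ) :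
    (∀ s : ℕ, γ ≤ √(s : ℝ) → ∃! Om : ℝ, IsCohenSolution q s (s - γ * √(s : ℝ)) Om) ∧
    ∃ a : ℝ, (0 < a ∧ a = phi (γ - a) / Phi (γ - a)) ∧
      (∀ b : ℝ, 0 < b → b = phi (γ - b) / Phi (γ - b) → b = a) ∧
      ∀ Om : ℕ → ℝ,
        (∀ᶠ s : ℕ in atTop, IsCohenSolution q s (s - γ * √(s : ℝ)) (Om s)) →
        Tendsto (fun s : ℕ => Om s / √(s : ℝ)) atTop (𝓝 a) ∧
        Tendsto (fun s : ℕ => √(s : ℝ) * delayProb q s (s - γ * √(s : ℝ) + Om s)) atTop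
          (𝓝 ((1 + policySeries q 1) * (phi (γ - a) / Phi (γ - a)))) ∧
        Tendsto (fun s : ℕ => √(s : ℝ) * rejectProb q s (s - γ * √(s : ℝ) + Om s)) atTop
          (𝓝 (phi (γ - a) / Phi (γ - a))) := by
  obtain ⟨hexists, a, ha, hunique, hlimits⟩ := mainTheorem2_general q hq hF γ hγ
  refine ⟨fun s hs => ?_, a, ha, fun b _ => hunique b, fun Om =>
    hlimits _ Om (isQED_sub_mul_sqrt γ)⟩
  exact hexists s _ (sub_mul_sqrt_mem_Ico hγ hs).1 (sub_mul_sqrt_mem_Ico hγ hs).2
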